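/- Fix integers $N\ge 1$ and $m\ge 1$, real gains $a_1,\dots,a_{m-1}$, and put $K_1=(0,-a_1,\dots,-a_{m-1})$, $K_2=(a_1,\dots,a_{m-1},1)$ (row vectors in $\mathbb{R}^{1\times m}$). Let $\mathcal S$ be a finite index set and, for each $s\in\mathcal S$, let $\mathcal G_s$ be a directed graph without self-edges on the nodes $1,\dots,N$, with a weight $\alpha^{ij}_s>0$ for every edge from $j$ to $i$; write $\mathcal N_i(s)$ for the set of $j$ such that $\mathcal G_s$ has an edge from $j$ to $i$. Let $\sigma:[0,\infty)\to\mathcal S$ be piecewise constant and right-continuous, with positive dwell time: the differences between consecutive switching times are bounded below by some $\tau_D>0$. Consider the $N$ agents with states $x_i(t)=(x_{i,1}(t),\dots,x_{i,m}(t))^T\in\mathbb{R}^m$, $$\dot x_{i,k}=x_{i,k+1}\ (1\le k\le m-1),\qquad \dot x_{i,m}=u_i,$$ under the protocol $$u_i(t)=K_1x_i(t)-\sum_{j\in\mathcal N_i(\sigma(t))}\alpha^{ij}_{\sigma(t)}K_2\bigl(x_i(t)-x_j(t)\bigr),\qquad i=1,\dots,N.$$ Solutions are continuous on $[0,\infty)$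 and satisfy these equations with right derivatives at every $t\ge 0$. The protocol is said to solve the consensus problem if for every solution (with arbitrary initial states) there is $x^*\in\mathbb{R}^m$ with $\lim_{t\to\infty}x_i(t)=x^*$ for all $i$. The topology $\mathcal G_{\sigma(t)}$ is called uniformly jointly quasi-strongly connected if there is $T>0$ such that for every $t>0$ the union graph $\bigcup_{s\in[t,t+T)}\mathcal G_{\sigma(s)}$ has a node from which there are directed paths to all other nodes. (i) If all complex roots of $s^{m-1}+a_{m-1}s^{m-2}+\cdots+a_2s+a_1$ have negative real part and $\mathcal G_{\sigma(t)}$ is uniformly jointly quasi-strongly connected, then the protocol solves the consensus problem. Moreover, for every solution there is $\bar x^*\in\mathbb{R}$ such that, for all $i$, $\lim_{t\to\infty}K_2x_i(t)=\bar x^*$ and $\lim_{t\to\infty}x_i(t)=(\bar x^*/a_1,0,\dots,0)^T$ (for $m=1$, where the polynomial is the constant $1$, read $a_1=1$). (ii) Conversely, for any such switching topology (connected or not), if the protocol solves the consensus problem, then all complex roots of that polynomial have negative real part. -/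

import Mathlib

open Filter Topology Set

namespace HighOrderConsensus

/-- A family of directed communication graphs on the agents `0, …, N - 1`, indexed by `S`, with
positive edge weights. `(graph s).Adj j i` is the edge starting from `j` and ending at `i`:
agent `i` receives information from agent `j`. `weight s i j` is the weight `α^{ij}_s` of that
edge (its value where there is no edge is irrelevant). There are no self-edges. -/
structure SwitchingTopology (N : ℕ) (S : Type*) where
  graph : S → Digraph (Fin N)
  loopless : ∀ s i, ¬ (graph s).Adj i i
  weight : S → Fin N → Fin N → ℝ
  weight_pos : ∀ s i j, (graph s).Adj j i → 0 < weight s i j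

/-- A signal on `[0, ∞)` (its values at negative times are irrelevant) is piecewise constant with
a positive dwell time: it is constant on `[0, t₀)` and on every `[tₖ, tₖ₊₁)`, where
`tₖ₊₁ - tₖ ≥ τ > 0`. The `tₖ` contain all switching instants; a point `tₖ` at which the signal
does not actually switch is allowed, so finitely many switches (or none) are covered. -/
def HasDwellTime {S : Type*} (σ : ℝ → S) : Prop :=
  ∃ τ : ℝ, 0 < τ ∧ ∃ t : ℕ → ℝ, 0 ≤ t 0 ∧ (∀ k, τ ≤ t (k + 1) - t k) ∧
    (∀ s ∈ Ico 0 (t 0), σ s = σ 0) ∧ ∀ k, ∀ s ∈ Ico (t k) (t (k + 1)), σ s = σ (t k)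

/-- Union of the graphs that are active at some time of `[t₁, t₂)`. -/
def unionGraph {N : ℕ} {S : Type*} (G : S → Digraph (Fin N)) (σ : ℝ → S) (t₁ t₂ : ℝ) :
    Digraph (Fin N) where
  Adj j i := ∃ t ∈ Ico t₁ t₂, (G (σ t)).Adj j i

/-- Some node (a center) is joined to every other node by a directed path starting from it. -/
def QuasiStronglyConnected {N : ℕ} (G : Digraph (Fin N)) : Prop :=
  ∃ c, ∀ i, i ≠ c → Relation.TransGen G.Adj c i

/-- For some `T > 0`, the union graph over `[t, t + T)` is quasi-strongly connected for all
`t > 0`. -/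
def UniformlyJointlyQSC {N : ℕ} {S : Type*} (G : S → Digraph (Fin N)) (σ : ℝ → S) : Prop :=
  ∃ T : ℝ, 0 < T ∧ ∀ t : ℝ, 0 < t → QuasiStronglyConnected (unionGraph G σ t (t + T))

/-- With `m = n + 1` and gains `a = (a₁, …, a_{m-1})`: `K₁ = (0, -a₁, …, -a_{m-1})`. -/
def K₁ {n : ℕ} (a : Fin n → ℝ) : Fin (n + 1) → ℝ :=
  Fin.cons (α := fun _ => ℝ) 0 (fun k => -a k)

/-- `K₂ = (a₁, …, a_{m-1}, 1)`. -/
def K₂ {n : ℕ} (a : Fin n → ℝ) : Fin (n + 1) → ℝ :=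
  Fin.snoc (α := fun _ => ℝ) a 1

/-- The polynomial `s^{m-1} + a_{m-1} s^{m-2} + ⋯ + a₂ s + a₁`. -/
noncomputable def gainPolynomial {n : ℕ} (a : Fin n → ℝ) : Polynomial ℝ :=
  Polynomial.X ^ n + ∑ k : Fin n, Polynomial.C (a k) * Polynomial.X ^ (k : ℕ)

/-- All complex roots lie in the open left half-plane. -/
def IsHurwitz (p : Polynomial ℝ) : Prop :=
  ∀ z : ℂ, Polynomial.aeval z p = 0 → z.re < 0

/-- Right-hand side `(x₂, …, x_m, u)` of the integrator chain of order `m = n + 1`. -/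
def integratorChain {n : ℕ} (x : Fin (n + 1) → ℝ) (u : ℝ) : Fin (n + 1) → ℝ :=
  Fin.snoc (α := fun _ => ℝ) (fun k : Fin n => x k.succ) u

open Classical in
/-- The state-feedback protocol
`uᵢ = K₁ xᵢ - ∑_{j ∈ 𝒩ᵢ(s)} α^{ij}_s K₂ (xᵢ - xⱼ)` when the active graph has index `s` and the
agents' states are `x`. -/
noncomputable def protocol {n N : ℕ} {S : Type*} (𝒯 : SwitchingTopology N S) (a : Fin n → ℝ)
    (s : S) (x : Fin N → Fin (n + 1) → ℝ) (i : Fin N) : ℝ :=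
  K₁ a ⬝ᵥ x i
    - ∑ j with (𝒯.graph s).Adj j i, 𝒯.weight s i j * (K₂ a ⬝ᵥ (x i - x j))

/-- `X` (where `X t i` is the state of agent `i` at time `t`) solves the closed-loop system on
`[0, ∞)`: it is continuous and satisfies the differential equations at every time, the derivative
being taken from the right because the right-hand side jumps at the switching instants. -/
def IsTrajectory {n N : ℕ} {S : Type*} (𝒯 : SwitchingTopology N S) (a : Fin n → ℝ) (σ : ℝ → S)
    (X : ℝ → Fin N → Fin (n + 1) → ℝ) : Prop :=
  ContinuousOn X (Ici 0) ∧
    ∀ t : ℝ, 0 ≤ t → ∀ i : Fin N,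
      HasDerivWithinAt (fun τ => X τ i)
        (integratorChain (X t i) (protocol 𝒯 a (σ t) (X t) i)) (Ici t) t

/-- The protocol solves the consensus problem: along every solution of the closed-loop system
(whatever the initial states), the states of all agents converge to one common vector. -/
def SolvesConsensus {n N : ℕ} {S : Type*} (𝒯 : SwitchingTopology N S) (a : Fin n → ℝ)
    (σ : ℝ → S) : Prop :=
  ∀ X : ℝ → Fin N → Fin (n + 1) → ℝ, IsTrajectory 𝒯 a σ X →
    ∃ xstar : Fin (n + 1) → ℝ, ∀ i, Tendsto (fun t => X t i) atTop (𝓝 xstar)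

end HighOrderConsensus

open HighOrderConsensus

namespace HighOrderConsensus

/-! ### First-order averaging with switching weights -/

section AveragingFlow

/-! The outputs `y i = K₂ a ⬝ᵥ x i` decouple: `K₁` cancels the drift of `K₂ x` along the chain,
leaving first-order averaging `y i' = ∑ j, w i j * (y j - y i)`. Its spread contracts geometrically.
Track a set of nodes at least `δ` below the maximum and a set at least `δ` above the minimum,
together covering all nodes. Their complements are disjoint, so a center misses one of them and some
edge enters it; in each window one set thus gains a node while `δ` shrinks by a fixed factor. After
as many windows as there are nodes, one set is everything (`exists_larger_sets`,
`exists_box_contraction`). Each agent then satisfies `p(d/dt) x₁ = y` with `p` stable and `y`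
convergent. Splitting off one root at a time makes the whole chain converge
(`exists_tendsto_of_stable_chain`); convergent derivatives tend to `0`, which fixes the limit.
Conversely, agents in agreement follow the chain with characteristic polynomial `s * p(s)`. A root
of `p` with nonnegative real part gives a non-convergent exponential or, at `0`, a double root and
linear drift. -/

theorem le_of_right_deriv_nonneg {g g' : ℝ → ℝ} {a b : ℝ} (hab : a ≤ b)
    (hc : ContinuousOn g (Icc a b))
    (hd : ∀ t ∈ Ico a b, HasDerivWithinAt g (g' t) (Ici t) t)
    (h : ∀ t ∈ Ico a b, 0 ≤ g' t) : g a ≤ g b := by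
  have := image_le_of_deriv_right_le_deriv_boundary (f := fun t => -g t) (f' := fun t => -g' t)
    (B := fun _ => -g a) (B' := fun _ => 0) hc.neg (fun t ht => (hd t ht).neg) le_rfl
    continuousOn_const (fun t _ => hasDerivWithinAt_const _ _ _)
    (fun t ht => by simpa using h t ht) (right_mem_Icc.2 hab)
  simpa using this

/-- `y` solves, on `[0, ∞)`, the averaging dynamics with nonnegative time-varying weights `w`
whose row sums are at most `B`. -/
structure AveragingFlow {ι : Type*} [Fintype ι] (w : ℝ → ι → ι → ℝ) (B : ℝ)
    (y : ℝ → ι → ℝ) : Prop where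
  nonneg : ∀ t i j, 0 ≤ w t i j
  sum_le : ∀ t i, ∑ j, w t i j ≤ B
  continuousOn : ∀ i, ContinuousOn (fun t => y t i) (Ici 0)
  deriv : ∀ t, 0 ≤ t → ∀ i,
    HasDerivWithinAt (fun r => y r i) (∑ j, w t i j * (y t j - y t i)) (Ici t) t

namespace AveragingFlow

variable {ι : Type*} [Fintype ι] {w : ℝ → ι → ι → ℝ} {B : ℝ} {y : ℝ → ι → ℝ}

/-- This symmetry turns each estimate from above into one from below. -/
theorem neg (F : AveragingFlow w B y) : AveragingFlow w B (fun t i => -y t i) where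
  nonneg := F.nonneg
  sum_le := F.sum_le
  continuousOn i := (F.continuousOn i).neg
  deriv t ht i := by
    have h : ∑ j, w t i j * (-y t j - -y t i) = -∑ j, w t i j * (y t j - y t i) := by
      rw [← Finset.sum_neg_distrib]
      exact Finset.sum_congr rfl fun j _ => by ring
    rw [h]
    exact (F.deriv t ht i).neg

/-- Maximum principle. -/
theorem le_of_le (F : AveragingFlow w B y) {s r M : ℝ} (hs : 0 ≤ s) (hsr : s ≤ r)
    (hM : ∀ i, y s i ≤ M) (i : ι) : y r i ≤ M := by
  -- The slope `ε` makes the barrier strict: at a node touching it, the right derivative of the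
  -- difference is negative, so the bound propagates to the right.
  suffices H : ∀ ε > 0, ∀ i, y r i ≤ M + ε * (r - s) by
    refine le_of_forall_pos_le_add fun ε hε => ?_
    have hpos : 0 < r - s + 1 := by linarith
    refine (H (ε / (r - s + 1)) (by positivity) i).trans ?_
    have : ε / (r - s + 1) * (r - s) ≤ ε := by
      rw [div_mul_eq_mul_div, div_le_iff₀ hpos]
      nlinarith
    linarith
  intro ε hε
  have hcont : ∀ i, ContinuousOn (fun t => y t i - (M + ε * (t - s))) (Icc s r) := fun i =>
    ((F.continuousOn i).mono fun t ht => hs.trans ht.1).sub (by fun_prop)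
  have key : Icc s r ⊆ {t | ∀ i, y t i - (M + ε * (t - s)) ≤ 0} := by
    refine IsClosed.Icc_subset_of_forall_mem_nhdsWithin ?_ (fun i => by simpa using hM i) ?_
    · have : {t | ∀ i, y t i - (M + ε * (t - s)) ≤ 0} ∩ Icc s r =
          (⋂ i, (Icc s r ∩ (fun t => y t i - (M + ε * (t - s))) ⁻¹' Iic 0)) ∩ Icc s r := by
        ext t
        simp only [mem_inter_iff, mem_ofPred_eq, mem_iInter, mem_preimage, mem_Iic]
        exact ⟨fun h => ⟨fun i => ⟨h.2, h.1 i⟩, h.2⟩, fun h => ⟨fun i => (h.1 i).2, h.2⟩⟩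
      rw [this]
      exact (isClosed_iInter fun i =>
        (hcont i).preimage_isClosed_of_isClosed isClosed_Icc isClosed_Iic).inter isClosed_Icc
    · rintro t ⟨ht, hst, htr⟩
      have ht0 : 0 ≤ t := hs.trans hst
      refine eventually_all.2 fun i => ?_
      have hd : HasDerivWithinAt (fun t => y t i - (M + ε * (t - s)))
          (∑ j, w t i j * (y t j - y t i) - ε) (Ioi t) t := by
        refine ((F.deriv t ht0 i).mono Ioi_subset_Ici_self).sub ?_
        simpa using ((((hasDerivWithinAt_id t (Ioi t)).sub_const s).const_mul ε).const_add M)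
      rcases (ht i).lt_or_eq with h | h
      · exact (hd.continuousWithinAt.eventually_lt_const h).mono fun _ => le_of_lt
      · have hneg : ∑ j, w t i j * (y t j - y t i) - ε < 0 := by
          have : ∑ j, w t i j * (y t j - y t i) ≤ 0 := Finset.sum_nonpos fun j _ =>
            mul_nonpos_of_nonneg_of_nonpos (F.nonneg t i j) (by have := ht j; linarith)
          linarith
        have hslope := (hasDerivWithinAt_iff_tendsto_slope' (by simp)).1 hd
        filter_upwards [hslope.eventually_lt_const hneg, self_mem_nhdsWithin] with r hr hrt
        rw [slope_def_field, h, sub_zero, div_neg_iff] at hr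
        have : 0 < r - t := sub_pos.2 hrt
        rcases hr with hr | hr
        · linarith [hr.2]
        · exact hr.1.le
  exact fun i => by linarith [key (right_mem_Icc.2 hsr) i]

/-- The gap `M - y i` has derivative at least `-B * (M - y i) + c`, the source `c` coming from node
`j` alone. Multiply by the integrating factor, which is at least `1` and so may be dropped in front
of `c`. -/
theorem exp_mul_gap_le (F : AveragingFlow w B y) (hB : 0 ≤ B) {s r M c : ℝ} (hs : 0 ≤ s)
    (hsr : s ≤ r) (hM : ∀ i, y s i ≤ M) (hc : 0 ≤ c) (i j : ι)
    (hw : ∀ t ∈ Ico s r, c ≤ w t i j * (M - y t j)) :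
    Real.exp (-(B * (r - s))) * (M - y s i + c * (r - s)) ≤ M - y r i := by
  have h := le_of_right_deriv_nonneg
    (g := fun t => Real.exp (B * (t - s)) * (M - y t i) - c * (t - s))
    (g' := fun t => Real.exp (B * (t - s)) * (B * 1) * (M - y t i) + Real.exp (B * (t - s)) *
      (-∑ j, w t i j * (y t j - y t i)) - c * 1) hsr ?_ ?_ ?_
  · simp only [sub_self, mul_zero, Real.exp_zero, one_mul, sub_zero] at h
    rw [Real.exp_neg, inv_mul_le_iff₀ (Real.exp_pos _)]
    linarith
  · refine ContinuousOn.sub (ContinuousOn.mul (by fun_prop) (continuousOn_const.sub ?_))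
      (by fun_prop)
    exact (F.continuousOn i).mono fun t ht => hs.trans ht.1
  · intro t ht
    have h1 : HasDerivWithinAt (fun t => t - s) 1 (Ici t) t :=
      (hasDerivWithinAt_id t _).sub_const s
    exact (((h1.const_mul B).exp).mul ((F.deriv t (hs.trans ht.1) i).const_sub M)).sub
      (h1.const_mul c)
  · intro t ht
    have hle : ∀ j, 0 ≤ M - y t j := fun j => sub_nonneg.2 (F.le_of_le hs ht.1 hM j)
    have h1 : -∑ j, w t i j * (y t j - y t i) =
        ∑ j, w t i j * (M - y t j) - (∑ j, w t i j) * (M - y t i) := by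
      rw [Finset.sum_mul, ← Finset.sum_sub_distrib, ← Finset.sum_neg_distrib]
      exact Finset.sum_congr rfl fun j _ => by ring
    have h2 : c ≤ ∑ j, w t i j * (M - y t j) := (hw t ht).trans <|
      Finset.single_le_sum (f := fun j => w t i j * (M - y t j))
        (fun j _ => mul_nonneg (F.nonneg t i j) (hle j)) (Finset.mem_univ j)
    have h3 := mul_le_mul_of_nonneg_right (F.sum_le t i) (hle i)
    have h4 : 1 ≤ Real.exp (B * (t - s)) :=
      Real.one_le_exp (mul_nonneg hB (sub_nonneg.2 ht.1))
    have h5 : c ≤ Real.exp (B * (t - s)) * c := le_mul_of_one_le_left hc h4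
    have h6 : Real.exp (B * (t - s)) * c ≤ Real.exp (B * (t - s)) *
      (B * (M - y t i) + -∑ j, w t i j * (y t j - y t i)) :=
      mul_le_mul_of_nonneg_left (by linarith) (Real.exp_pos _).le
    nlinarith

theorem exp_mul_gap_le_gap (F : AveragingFlow w B y) (hB : 0 ≤ B) {s r M δ L : ℝ} (hs : 0 ≤ s)
    (hsr : s ≤ r) (hL : r - s ≤ L) (hM : ∀ i, y s i ≤ M) (hδ : 0 ≤ δ) (i : ι)
    (hi : δ ≤ M - y s i) : Real.exp (-(B * L)) * δ ≤ M - y r i := by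
  have h := F.exp_mul_gap_le hB hs hsr hM le_rfl i i fun t ht =>
    mul_nonneg (F.nonneg t i i) (sub_nonneg.2 (F.le_of_le hs ht.1 hM i))
  refine le_trans ?_ h
  gcongr
  linarith

/-- A node that listens long enough to a node staying below the maximum leaves the maximum. -/
theorem exp_mul_gap_le_gap_of_edge (F : AveragingFlow w B y) (hB : 0 ≤ B)
    {t T s τ α M δ : ℝ} (ht : 0 ≤ t) (hts : t ≤ s) (hτ : 0 ≤ τ) (hsT : s + τ ≤ t + T)
    (hα : 0 ≤ α) (hM : ∀ i, y t i ≤ M) (hδ : 0 ≤ δ) {i j : ι} (hj : δ ≤ M - y t j)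
    (hw : ∀ r ∈ Ico s (s + τ), α ≤ w r i j) :
    Real.exp (-(B * T)) * (α * (Real.exp (-(B * T)) * δ) * τ) ≤ M - y (t + T) i := by
  have hMs : ∀ i, y s i ≤ M := F.le_of_le ht hts hM
  have h := F.exp_mul_gap_le hB (ht.trans hts) (r := s + τ) (by linarith) hMs
    (c := α * (Real.exp (-(B * T)) * δ)) (by positivity) i j fun r hr =>
      mul_le_mul (hw r hr) (F.exp_mul_gap_le_gap hB ht (hts.trans hr.1) (by linarith [hr.2])
        hM hδ j hj) (by positivity) (F.nonneg r i j)
  rw [add_sub_cancel_left] at h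
  have h' := F.exp_mul_gap_le_gap hB (ht.trans (hts.trans (by linarith))) hsT le_rfl
    (F.le_of_le (ht.trans hts) (by linarith) hMs) (by
      have := sub_nonneg.2 (hMs i); positivity) i h
  refine le_trans ?_ h'
  -- The decays during and after the listening interval merge into one over a length at most `T`.
  rw [← mul_assoc (Real.exp _) (Real.exp _), ← Real.exp_add]
  have := sub_nonneg.2 (hMs i)
  gcongr
  · nlinarith
  · linarith

/-- Connectivity over the window `[t, t + T]`: of two disjoint nonempty sets of nodes, one has an
incoming edge that carries weight at least `α` for a duration `τ`. -/
def WindowConnected {ι : Type*} (w : ℝ → ι → ι → ℝ) (τ α T t : ℝ) : Prop :=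
  ∀ P Q : Finset ι, P.Nonempty → Q.Nonempty → Disjoint P Q →
    ∃ i j s, t ≤ s ∧ s + τ ≤ t + T ∧ ((i ∈ P ∧ j ∉ P) ∨ (i ∈ Q ∧ j ∉ Q)) ∧
      ∀ r ∈ Ico s (s + τ), α ≤ w r i j

variable {τ α T : ℝ}

/-- An edge entering `Pᶜ` or `Qᶜ` starts in `P` or `Q` respectively, and its head joins that set.
The two bounds on `κ` serve old members and the newcomer. -/
theorem exists_larger_sets [DecidableEq ι] (F : AveragingFlow w B y) (hB : 0 ≤ B) {t m M δ κ : ℝ}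
    (ht : 0 ≤ t) (hτ : 0 ≤ τ) (hα : 0 ≤ α) (hT : 0 ≤ T) (hconn : WindowConnected w τ α T t)
    (hκ₁ : κ ≤ Real.exp (-(B * T)))
    (hκ₂ : κ ≤ Real.exp (-(B * T)) * (α * Real.exp (-(B * T)) * τ)) (hδ : 0 ≤ δ)
    (hm : ∀ i, m ≤ y t i) (hM : ∀ i, y t i ≤ M) {P Q : Finset ι} (hPQ : P ∪ Q = Finset.univ)
    (hP : ∀ i ∈ P, δ ≤ M - y t i) (hQ : ∀ i ∈ Q, δ ≤ y t i - m) :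
    ∃ P' Q' : Finset ι, P' ∪ Q' = Finset.univ ∧ (∀ i ∈ P', κ * δ ≤ M - y (t + T) i) ∧
      (∀ i ∈ Q', κ * δ ≤ y (t + T) i - m) ∧
      (P' = Finset.univ ∨ Q' = Finset.univ ∨ P.card + Q.card + 1 ≤ P'.card + Q'.card) := by
  have hP1 : ∀ i ∈ P, κ * δ ≤ M - y (t + T) i := fun i hi =>
    (mul_le_mul_of_nonneg_right hκ₁ hδ).trans
      (F.exp_mul_gap_le_gap hB ht (by linarith) (by linarith) hM hδ i (hP i hi))
  have hQ1 : ∀ i ∈ Q, κ * δ ≤ y (t + T) i - m := fun i hi => by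
    have := F.neg.exp_mul_gap_le_gap hB ht (r := t + T) (M := -m) (by linarith)
      (L := T) (by linarith) (fun i => neg_le_neg (hm i)) hδ i (by linarith [hQ i hi])
    linarith [mul_le_mul_of_nonneg_right hκ₁ hδ]
  by_cases hPu : P = Finset.univ
  · exact ⟨P, Q, hPQ, hP1, hQ1, Or.inl hPu⟩
  by_cases hQu : Q = Finset.univ
  · exact ⟨P, Q, hPQ, hP1, hQ1, Or.inr (Or.inl hQu)⟩
  obtain ⟨i, j, s, hts, hsT, hij, hw⟩ := hconn Pᶜ Qᶜ
    (by rwa [Finset.nonempty_iff_ne_empty, Ne, Finset.compl_eq_empty_iff])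
    (by rwa [Finset.nonempty_iff_ne_empty, Ne, Finset.compl_eq_empty_iff]) (by
      rw [Finset.disjoint_iff_inter_eq_empty, ← Finset.compl_union, hPQ, Finset.compl_univ])
  have hκδ := mul_le_mul_of_nonneg_right hκ₂ hδ
  simp only [Finset.mem_compl, not_not] at hij
  rcases hij with ⟨hi, hj⟩ | ⟨hi, hj⟩
  · refine ⟨insert i P, Q, by rw [Finset.insert_union, hPQ]; simp, ?_, hQ1, ?_⟩
    · intro k hk
      rcases Finset.mem_insert.1 hk with rfl | hk
      · have := F.exp_mul_gap_le_gap_of_edge hB ht hts hτ hsT hα hM hδ (hP j hj) hw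
        linarith
      · exact hP1 k hk
    · rw [Finset.card_insert_of_notMem hi]
      right; right; omega
  · refine ⟨P, insert i Q, by rw [Finset.union_insert, hPQ]; simp, hP1, ?_, ?_⟩
    · intro k hk
      rcases Finset.mem_insert.1 hk with rfl | hk
      · have := F.neg.exp_mul_gap_le_gap_of_edge hB ht hts hτ hsT hα (M := -m)
          (fun i => neg_le_neg (hm i)) hδ (by linarith [hQ j hj]) hw
        linarith
      · exact hQ1 k hk
    · rw [Finset.card_insert_of_notMem hi]
      right; right; omega

/-- The spread of an averaging flow contracts over `card ι` connected windows. -/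
theorem exists_box_contraction (F : AveragingFlow w B y) (hB : 0 ≤ B) (hτ : 0 < τ) (hα : 0 < α)
    (hT : 0 ≤ T) {t₀ : ℝ} (ht₀ : 0 ≤ t₀) (hconn : ∀ t, t₀ ≤ t → WindowConnected w τ α T t) :
    ∃ q : ℝ, 0 ≤ q ∧ q < 1 ∧ ∀ t m M, t₀ ≤ t → m ≤ M → (∀ i, m ≤ y t i) → (∀ i, y t i ≤ M) →
      ∃ t' m' M', t ≤ t' ∧ m' ≤ M' ∧ M' - m' = q * (M - m) ∧
        (∀ i, m' ≤ y t' i) ∧ (∀ i, y t' i ≤ M') := by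
  classical
  set N := Fintype.card ι
  set κ := min (Real.exp (-(B * T))) (Real.exp (-(B * T)) * (α * Real.exp (-(B * T)) * τ))
  have hκ0 : 0 < κ := lt_min (by positivity) (by positivity)
  have hκ1 : κ ≤ 1 := (min_le_left _ _).trans (Real.exp_le_one_iff.2 (by
    have := mul_nonneg hB hT; linarith))
  have hκN0 : 0 < κ ^ N := by positivity
  have hκN1 : κ ^ N ≤ 1 := pow_le_one₀ hκ0.le hκ1
  refine ⟨1 - κ ^ N / 2, by linarith, by linarith, fun t m M ht hmM hm hM => ?_⟩
  have ht0 : 0 ≤ t := ht₀.trans ht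
  have hm' : ∀ r, t ≤ r → ∀ i, m ≤ y r i := fun r hr i => by
    have := F.neg.le_of_le ht0 hr (M := -m) (fun i => neg_le_neg (hm i)) i
    linarith
  have hM' : ∀ r, t ≤ r → ∀ i, y r i ≤ M := fun r hr i => F.le_of_le ht0 hr hM i
  -- Half the spread: every node is then initially in `P` or `Q`.
  set δ := (M - m) / 2 with hδdef
  have hδ : 0 ≤ δ := by linarith
  have main : ∀ k : ℕ, ∃ P Q : Finset ι, P ∪ Q = Finset.univ ∧
      (∀ i ∈ P, κ ^ k * δ ≤ M - y (t + k * T) i) ∧ (∀ i ∈ Q, κ ^ k * δ ≤ y (t + k * T) i - m) ∧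
      (P = Finset.univ ∨ Q = Finset.univ ∨ N + k ≤ P.card + Q.card) := by
    intro k
    induction k with
    | zero =>
      refine ⟨Finset.univ.filter fun i => δ ≤ M - y t i, Finset.univ.filter fun i => δ ≤ y t i - m,
        ?_, by simp, by simp, ?_⟩
      · ext i
        simp only [Finset.mem_union, Finset.mem_filter, Finset.mem_univ, true_and, iff_true]
        by_contra! h
        linarith [h.1, h.2]
      · refine Or.inr (Or.inr ?_)
        refine le_trans ?_ (Finset.card_union_le _ _)
        change Finset.univ.card ≤ _
        refine Finset.card_le_card fun i _ => ?_
        simp only [Finset.mem_union, Finset.mem_filter, Finset.mem_univ, true_and]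
        by_contra! h
        linarith [h.1, h.2]
    | succ k ih =>
      obtain ⟨P, Q, hPQ, hP, hQ, h⟩ := ih
      have hk : 0 ≤ (k : ℝ) * T := by positivity
      obtain ⟨P', Q', hPQ', hP', hQ', h'⟩ := F.exists_larger_sets hB (t := t + k * T) (by linarith)
        hτ.le hα.le hT (hconn _ (by linarith)) (min_le_left _ _) (min_le_right _ _)
        (by positivity : 0 ≤ κ ^ k * δ) (hm' _ (by linarith)) (hM' _ (by linarith)) hPQ hP hQ
      have e1 : t + ((k + 1 : ℕ) : ℝ) * T = t + k * T + T := by push_cast; ring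
      have e2 : κ ^ (k + 1) * δ = κ * (κ ^ k * δ) := by ring
      rw [e1, e2]
      -- A full set stays full, and by itself it covers all nodes, so the other may be discarded.
      rcases h with h | h | h
      · refine ⟨Finset.univ, ∅, by simp, ?_, by simp, Or.inl rfl⟩
        intro i _
        have := F.exp_mul_gap_le_gap hB (s := t + k * T) (r := t + k * T + T) (by linarith)
          (by linarith) (L := T) (by linarith) (hM' _ (by linarith))
          (by positivity : 0 ≤ κ ^ k * δ) i (hP i (h ▸ Finset.mem_univ i))
        exact (mul_le_mul_of_nonneg_right (min_le_left _ _) (by positivity)).trans this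
      · refine ⟨∅, Finset.univ, by simp, by simp, ?_, Or.inr (Or.inl rfl)⟩
        intro i _
        have := F.neg.exp_mul_gap_le_gap hB (s := t + k * T) (r := t + k * T + T) (M := -m)
          (by linarith) (by linarith) (L := T) (by linarith)
          (fun i => neg_le_neg (hm' _ (by linarith) i))
          (by positivity : 0 ≤ κ ^ k * δ) i (by linarith [hQ i (h ▸ Finset.mem_univ i)])
        have h2 := (mul_le_mul_of_nonneg_right
          (min_le_left _ _ : κ ≤ _) (by positivity : 0 ≤ κ ^ k * δ)).trans this
        linarith
      · exact ⟨P', Q', hPQ', hP', hQ', h'.imp_right (Or.imp_right fun h' => by omega)⟩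
  obtain ⟨P, Q, hPQ, hP, hQ, h⟩ := main N
  have hNT : 0 ≤ (N : ℝ) * T := by positivity
  have hbm := hm' (t + N * T) (by linarith)
  have hbM := hM' (t + N * T) (by linarith)
  have hq : κ ^ N * δ = κ ^ N / 2 * (M - m) := by rw [hδdef]; ring
  have hqle : κ ^ N * δ ≤ M - m := by
    have := mul_le_mul_of_nonneg_right hκN1 hδ
    linarith
  have hor : P = Finset.univ ∨ Q = Finset.univ := by
    rcases h with h | h | h
    · exact Or.inl h
    · exact Or.inr h
    · left
      have h1 : P.card ≤ N := Finset.card_le_univ P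
      have h2 : Q.card ≤ N := Finset.card_le_univ Q
      exact Finset.eq_univ_of_card P (by omega)
  rcases hor with rfl | rfl
  · refine ⟨t + N * T, m, M - κ ^ N * δ, by linarith, by linarith, by rw [hq]; ring, hbm,
      fun i => ?_⟩
    linarith [hP i (Finset.mem_univ i)]
  · refine ⟨t + N * T, m + κ ^ N * δ, M, by linarith, by linarith, by rw [hq]; ring,
      fun i => ?_, hbM⟩
    linarith [hQ i (Finset.mem_univ i)]

theorem exists_tendsto [Nonempty ι] (F : AveragingFlow w B y) (hB : 0 ≤ B) (hτ : 0 < τ)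
    (hα : 0 < α) (hT : 0 ≤ T) {t₀ : ℝ} (ht₀ : 0 ≤ t₀)
    (hconn : ∀ t, t₀ ≤ t → WindowConnected w τ α T t) :
    ∃ L : ℝ, ∀ i, Tendsto (fun t => y t i) atTop (𝓝 L) := by
  obtain ⟨q, hq0, hq1, hstep⟩ := F.exists_box_contraction hB hτ hα hT ht₀ hconn
  obtain ⟨imax, hmax⟩ := Finite.exists_max (y t₀)
  obtain ⟨imin, hmin⟩ := Finite.exists_min (y t₀)
  set d := y t₀ imax - y t₀ imin
  have iter : ∀ k : ℕ, ∃ t m M, t₀ ≤ t ∧ m ≤ M ∧ M - m = q ^ k * d ∧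
      (∀ i, m ≤ y t i) ∧ (∀ i, y t i ≤ M) := by
    intro k
    induction k with
    | zero => exact ⟨t₀, _, _, le_rfl, hmin imax, by simp [d], hmin, hmax⟩
    | succ k ih =>
      obtain ⟨t, m, M, ht, hmM, hd, hm, hM⟩ := ih
      obtain ⟨t', m', M', ht', hmM', hd', hm', hM'⟩ := hstep t m M ht hmM hm hM
      exact ⟨t', m', M', ht.trans ht', hmM', by rw [hd', hd]; ring, hm', hM'⟩
  -- Boxes are invariant by the maximum principle. Comparing times and nodes together yields both
  -- the Cauchy property and a common limit.
  have close : ∀ ε > 0, ∃ t, ∀ r ≥ t, ∀ r' ≥ t, ∀ i j, dist (y r i) (y r' j) < ε := by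
    intro ε hε
    have hlim : Tendsto (fun k : ℕ => q ^ k * d) atTop (𝓝 (0 * d)) :=
      (tendsto_pow_atTop_nhds_zero_of_lt_one hq0 hq1).mul_const d
    rw [zero_mul] at hlim
    obtain ⟨k, hk⟩ := (hlim.eventually_lt_const hε).exists
    obtain ⟨t, m, M, ht, -, hd, hm, hM⟩ := iter k
    have ht0 := ht₀.trans ht
    have hm' : ∀ r, t ≤ r → ∀ i, m ≤ y r i := fun r hr i => by
      have := F.neg.le_of_le ht0 hr (M := -m) (fun i => neg_le_neg (hm i)) i
      linarith
    have hM' : ∀ r, t ≤ r → ∀ i, y r i ≤ M := fun r hr i => F.le_of_le ht0 hr hM i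
    refine ⟨t, fun r hr r' hr' i j => ?_⟩
    rw [Real.dist_eq, abs_lt]
    constructor <;> linarith [hm' r hr i, hm' r' hr' j, hM' r hr i, hM' r' hr' j]
  obtain ⟨i₀⟩ := ‹Nonempty ι›
  have hc : Cauchy (map (fun t => y t i₀) atTop) := by
    rw [Metric.cauchy_iff]
    refine ⟨inferInstance, fun ε hε => ?_⟩
    obtain ⟨t, ht⟩ := close ε hε
    refine ⟨(fun t => y t i₀) '' Ici t, image_mem_map (Ici_mem_atTop t), ?_⟩
    rintro _ ⟨r, hr, rfl⟩ _ ⟨r', hr', rfl⟩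
    exact ht r hr r' hr' _ _
  obtain ⟨L, hL⟩ := CompleteSpace.complete hc
  refine ⟨L, fun i => tendsto_of_tendsto_of_dist (f₁ := fun t => y t i₀) hL ?_⟩
  rw [Metric.tendsto_atTop]
  intro ε hε
  obtain ⟨t, ht⟩ := close ε hε
  refine ⟨t, fun r hr => ?_⟩
  simpa [Real.dist_eq, abs_abs] using ht r hr r hr i₀ i

end AveragingFlow

end AveragingFlow

end HighOrderConsensus

namespace HighOrderConsensus

/-! ### Stable linear filters -/

section StableFilter

/-- A stable first-order linear filter with a convergent input has a convergent output. -/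
theorem tendsto_of_stable_first_order {f g : ℝ → ℂ} {z c : ℂ} (hz : z.re < 0)
    (hf : ContinuousOn f (Ici 0))
    (hd : ∀ t, 0 ≤ t → HasDerivWithinAt f (z * f t + g t) (Ici t) t)
    (hg : Tendsto g atTop (𝓝 c)) : Tendsto f atTop (𝓝 (-c / z)) := by
  have hz0 : z ≠ 0 := fun h => by simp [h] at hz
  set μ := -z.re with hμ
  have hμ0 : 0 < μ := by linarith
  rw [Metric.tendsto_atTop]
  intro ε hε
  have hη : 0 < ε / 2 * μ := by positivity
  obtain ⟨T₀, hT₀⟩ := (Metric.tendsto_atTop.1 hg) _ hη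
  set T := max T₀ 0
  have hT0 : 0 ≤ T := le_max_right _ _
  -- Variation of constants about the equilibrium `-c / z`: only the input error `g t - c` remains
  -- in the derivative.
  set F : ℝ → ℂ := fun t : ℝ => Complex.exp (-z * t) * (f t + c / z)
  have hFd : ∀ t : ℝ, 0 ≤ t →
      HasDerivWithinAt F (Complex.exp (-z * t) * (g t - c)) (Ici t) t := by
    intro t ht
    have h1 : HasDerivWithinAt (fun t : ℝ => -z * (t : ℂ)) (-z * 1) (Ici t) t :=
      (Complex.ofRealCLM.hasDerivAt.hasDerivWithinAt).const_mul (-z)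
    refine (h1.cexp.mul ((hd t ht).add_const (c / z))).congr_deriv ?_
    have hcz : z * (c / z) = c := mul_div_cancel₀ c hz0
    linear_combination (-Complex.exp (-z * t)) * hcz
  have hnorm : ∀ t : ℝ, ‖Complex.exp (-z * t)‖ = Real.exp (μ * t) := fun t => by
    rw [Complex.norm_exp]; simp [hμ]
  have hbound : ∀ t, T ≤ t → ‖F t‖ ≤ ‖F T‖ + ε / 2 * (Real.exp (μ * t) - Real.exp (μ * T)) := by
    intro t ht
    refine image_norm_le_of_norm_deriv_right_le_deriv_boundary (f := F) (a := T) (b := t)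
      (f' := fun t : ℝ => Complex.exp (-z * t) * (g t - c))
      (B := fun t => ‖F T‖ + ε / 2 * (Real.exp (μ * t) - Real.exp (μ * T)))
      (B' := fun t => ε / 2 * (Real.exp (μ * t) * (μ * 1))) ?_ ?_ ?_ ?_ ?_ (right_mem_Icc.2 ht)
    · exact ContinuousOn.mul (by fun_prop)
        ((hf.mono fun r hr => hT0.trans hr.1).add continuousOn_const)
    · exact fun r hr => hFd r (hT0.trans hr.1)
    · simp
    · intro r
      exact ((((hasDerivAt_id r).const_mul μ).exp.sub_const _).const_mul _).const_add _
    · intro r hr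
      rw [norm_mul, hnorm]
      have := (hT₀ r ((le_max_left _ _).trans hr.1)).le
      rw [dist_eq_norm] at this
      calc _ ≤ Real.exp (μ * r) * (ε / 2 * μ) := by gcongr
        _ = _ := by ring
  have hdecay : Tendsto (fun t => ‖F T‖ * Real.exp (-(μ * t))) atTop (𝓝 (‖F T‖ * 0)) :=
    (Real.tendsto_exp_neg_atTop_nhds_zero.comp (tendsto_id.const_mul_atTop hμ0)).const_mul _
  rw [mul_zero] at hdecay
  obtain ⟨T₁, hT₁⟩ := eventually_atTop.1 (hdecay.eventually_lt_const (half_pos hε))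
  refine ⟨max T T₁, fun t ht => ?_⟩
  have hb := hbound t ((le_max_left _ _).trans ht)
  have hs := hT₁ t ((le_max_right _ _).trans ht)
  have hFt : ‖F t‖ = Real.exp (μ * t) * ‖f t + c / z‖ := by rw [norm_mul, hnorm]
  rw [dist_eq_norm, neg_div, sub_neg_eq_add]
  have he : 0 < Real.exp (μ * t) := Real.exp_pos _
  rw [Real.exp_neg, ← div_eq_mul_inv, div_lt_iff₀ he] at hs
  have hTpos := Real.exp_pos (μ * T)
  rw [hFt] at hb
  have : Real.exp (μ * t) * ‖f t + c / z‖ < Real.exp (μ * t) * ε := by nlinarith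
  exact lt_of_mul_lt_mul_left this he.le

/-- If `x 0, …, x n` is a chain of derivatives and `p(d/dt) x 0` converges, where `p` is a stable
monic polynomial of degree `n`, then the whole chain converges. -/
theorem exists_tendsto_of_stable_chain (n : ℕ) (p : Polynomial ℂ) (hp : p.Monic)
    (hdeg : p.natDegree = n) (hroot : ∀ z, p.IsRoot z → z.re < 0) (x : ℕ → ℝ → ℂ)
    (hcont : ∀ k ≤ n, ContinuousOn (x k) (Ici 0))
    (hd : ∀ k < n, ∀ t, 0 ≤ t → HasDerivWithinAt (x k) (x (k + 1) t) (Ici t) t)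
    (hlim : ∃ c, Tendsto (fun t => ∑ k ∈ Finset.range (n + 1), p.coeff k * x k t) atTop (𝓝 c)) :
    ∀ k ≤ n, ∃ c, Tendsto (x k) atTop (𝓝 c) := by
  induction n generalizing p with
  | zero =>
    intro k hk
    obtain rfl : k = 0 := by omega
    have h1 : p = 1 := hp.natDegree_eq_zero.1 hdeg
    simpa [h1] using hlim
  | succ n ih =>
    obtain ⟨c, hc⟩ := hlim
    obtain ⟨z, hz⟩ := IsAlgClosed.exists_root p (by
      rw [Polynomial.degree_eq_natDegree hp.ne_zero, hdeg]; exact_mod_cast Nat.succ_ne_zero n)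
    -- With `p = (X - z) q`, the function `q(d/dt) x 0` is a first-order filter with pole `z` and
    -- input `p(d/dt) x 0`, so it converges and `q` inherits the hypotheses.
    obtain ⟨q, rfl⟩ := Polynomial.dvd_iff_isRoot.2 hz
    have hq : q.Monic := (Polynomial.monic_X_sub_C z).of_mul_monic_left hp
    have hqdeg : q.natDegree = n := by
      rw [(Polynomial.monic_X_sub_C z).natDegree_mul hq, Polynomial.natDegree_X_sub_C] at hdeg
      omega
    have hq0 : q.coeff (n + 1) = 0 := Polynomial.coeff_eq_zero_of_natDegree_lt (by omega)
    have hsplit : ∀ t, ∑ k ∈ Finset.range (n + 1), q.coeff k * x (k + 1) t =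
        z * ∑ k ∈ Finset.range (n + 1), q.coeff k * x k t +
        ∑ k ∈ Finset.range (n + 1 + 1), ((Polynomial.X - Polynomial.C z) * q).coeff k * x k t := by
      intro t
      have e : ∀ k, ((Polynomial.X - Polynomial.C z) * q).coeff k * x k t =
          (Polynomial.X * q).coeff k * x k t - z * (q.coeff k * x k t) := fun k => by
        rw [sub_mul, Polynomial.coeff_sub, Polynomial.coeff_C_mul]; ring
      simp only [e]
      have h1 : ∑ k ∈ Finset.range (n + 1 + 1), (Polynomial.X * q).coeff k * x k t =
          ∑ k ∈ Finset.range (n + 1), q.coeff k * x (k + 1) t := by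
        rw [Finset.sum_range_succ']
        simp [Polynomial.coeff_X_mul]
      have h2 : ∑ k ∈ Finset.range (n + 1 + 1), z * (q.coeff k * x k t) =
          z * ∑ k ∈ Finset.range (n + 1), q.coeff k * x k t := by
        rw [Finset.sum_range_succ, hq0, Finset.mul_sum]
        simp
      rw [Finset.sum_sub_distrib, h1, h2]
      ring
    have hqlim := tendsto_of_stable_first_order (hroot z hz)
      (f := fun t => ∑ k ∈ Finset.range (n + 1), q.coeff k * x k t)
      (continuousOn_finsetSum _ fun k hk =>
        continuousOn_const.mul (hcont k (by have := Finset.mem_range.1 hk; omega)))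
      (fun t ht => by
        rw [← hsplit]
        exact HasDerivWithinAt.fun_sum fun k hk =>
          (hd k (Finset.mem_range.1 hk) t ht).const_mul _) hc
    have hlow := ih q hq hqdeg (fun w hw => hroot w (by
        rw [Polynomial.IsRoot.def, Polynomial.eval_mul, hw.eq_zero, mul_zero]))
      (fun k hk => hcont k (by omega)) (fun k hk => hd k (by omega)) ⟨_, hqlim⟩
    intro k hk
    rcases hk.lt_or_eq with hk | rfl
    · exact hlow k (by omega)
    -- The top derivative lies beyond the induction; it is solved for using that `p` is monic.
    · choose! l hl using hlow
      have hlead : ((Polynomial.X - Polynomial.C z) * q).coeff (n + 1) = 1 := by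
        rw [← hdeg]; exact hp.coeff_natDegree
      refine ⟨_, (hc.sub (tendsto_finsetSum (Finset.range (n + 1)) fun k hk =>
        (hl k (by have := Finset.mem_range.1 hk; omega)).const_mul
          (((Polynomial.X - Polynomial.C z) * q).coeff k))).congr fun t => ?_⟩
      rw [Finset.sum_range_succ, hlead]
      ring

/-- If a function and its right derivative both converge, the derivative tends to zero. -/
theorem eq_zero_of_tendsto_right_deriv {f f' : ℝ → ℂ} {c d : ℂ} (hf : ContinuousOn f (Ici 0))
    (hd : ∀ t, 0 ≤ t → HasDerivWithinAt f (f' t) (Ici t) t) (hc : Tendsto f atTop (𝓝 c))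
    (hd' : Tendsto f' atTop (𝓝 d)) : d = 0 := by
  -- As a filter with pole `-1` and input `f + f'`, `f` tends to `c + d`.
  have h := tendsto_of_stable_first_order (z := -1) (g := fun t => f t + f' t) (by simp) hf
    (fun t ht => by convert hd t ht using 1; ring) (hc.add hd')
  have := tendsto_nhds_unique hc h
  rw [neg_div_neg_eq, div_one] at this
  simpa using this

end StableFilter

/-! ### The gain polynomial and the output `K₂ x` -/

section Gains

variable {n : ℕ} (a : Fin n → ℝ)

theorem K₂_dotProduct (v : Fin (n + 1) → ℝ) :
    K₂ a ⬝ᵥ v = ∑ k : Fin n, a k * v k.castSucc + v (Fin.last n) := by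
  simp [K₂, dotProduct, Fin.sum_univ_castSucc]

theorem K₁_dotProduct (v : Fin (n + 1) → ℝ) :
    K₁ a ⬝ᵥ v = -∑ k : Fin n, a k * v k.succ := by
  simp [K₁, dotProduct, Fin.sum_univ_succ]

/-- `K₁` carries the gains negated and shifted by one place, exactly as the chain shifts the state.
This reduces consensus to first order. -/
theorem K₂_dotProduct_integratorChain (v : Fin (n + 1) → ℝ) (u : ℝ) :
    K₂ a ⬝ᵥ integratorChain v (K₁ a ⬝ᵥ v + u) = u := by
  rw [K₂_dotProduct, K₁_dotProduct]
  simp [integratorChain]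

theorem coeff_gainPolynomial_castSucc (k : Fin n) : (gainPolynomial a).coeff k = a k := by
  have : (k : ℕ) ≠ n := k.2.ne
  simp [gainPolynomial, Polynomial.coeff_X_pow, this,
    Fin.val_inj]

theorem coeff_gainPolynomial (k : Fin (n + 1)) : (gainPolynomial a).coeff k = K₂ a k := by
  refine Fin.lastCases ?_ (fun k => ?_) k
  · have : ∀ k : Fin n, n ≠ k := fun k => k.2.ne'
    simp [gainPolynomial, K₂, Polynomial.coeff_X_pow, this]
  · simpa [K₂] using coeff_gainPolynomial_castSucc a k

theorem gainPolynomial_monic : (gainPolynomial a).Monic :=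
  Polynomial.monic_X_pow_add (Polynomial.degree_sum_fin_lt a)

theorem gainPolynomial_natDegree : (gainPolynomial a).natDegree = n := by
  rw [gainPolynomial, Polynomial.natDegree_eq_of_degree_eq
    (Polynomial.degree_add_eq_left_of_degree_lt (by
      rw [Polynomial.degree_X_pow]; exact Polynomial.degree_sum_fin_lt a)),
    Polynomial.natDegree_X_pow]

theorem aeval_gainPolynomial (z : ℂ) :
    Polynomial.aeval z (gainPolynomial a) = z ^ n + ∑ k : Fin n, (a k : ℂ) * z ^ (k : ℕ) := by
  simp [gainPolynomial]

/-- A chain of integrators whose output `K₂ x` converges is driven to rest. -/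
theorem tendsto_of_isHurwitz {a : Fin n → ℝ} (ha : IsHurwitz (gainPolynomial a))
    {x : ℝ → Fin (n + 1) → ℝ} {c : ℝ} (hcont : ContinuousOn x (Ici 0))
    (hd : ∀ t, 0 ≤ t → ∀ k : Fin n,
      HasDerivWithinAt (fun r => x r k.castSucc) (x t k.succ) (Ici t) t)
    (hc : Tendsto (fun t => K₂ a ⬝ᵥ x t) atTop (𝓝 c)) :
    Tendsto x atTop (𝓝 (Pi.single 0 (c / K₂ a 0))) := by
  set p := (gainPolynomial a).map Complex.ofRealHom with hpdef
  set ξ : ℕ → ℝ → ℂ := fun k t => if h : k < n + 1 then (x t ⟨k, h⟩ : ℂ) else 0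
  have hξ : ∀ k : Fin (n + 1), ξ k = fun t => (x t k : ℂ) := fun k => by
    funext t; exact dif_pos k.2
  have hp : p.Monic := (gainPolynomial_monic a).map _
  have hdeg : p.natDegree = n := by
    rw [hpdef, Polynomial.natDegree_map]; exact gainPolynomial_natDegree a
  have hroot : ∀ z, p.IsRoot z → z.re < 0 := fun z hz => ha z (by
    rw [Polynomial.IsRoot.def, hpdef, Polynomial.eval_map] at hz
    exact hz)
  have hξc : ∀ k ≤ n, ContinuousOn (ξ k) (Ici 0) := fun k hk => by
    have := hξ ⟨k, Nat.lt_succ_of_le hk⟩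
    simp only at this
    rw [this]
    exact Complex.continuous_ofReal.comp_continuousOn ((continuousOn_pi.1 hcont) _)
  have hξd : ∀ k < n, ∀ t, 0 ≤ t → HasDerivWithinAt (ξ k) (ξ (k + 1) t) (Ici t) t := by
    intro k hk t ht
    have e1 := hξ (Fin.castSucc ⟨k, hk⟩)
    have e2 := hξ (Fin.succ ⟨k, hk⟩)
    simp only [Fin.val_castSucc, Fin.val_succ] at e1 e2
    rw [e1, e2]
    exact (hd t ht ⟨k, hk⟩).ofReal_comp
  have hsum : ∀ t, ∑ k ∈ Finset.range (n + 1), p.coeff k * ξ k t =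
      ((K₂ a ⬝ᵥ x t : ℝ) : ℂ) := by
    intro t
    rw [Finset.sum_range, dotProduct, Complex.ofReal_sum]
    refine Finset.sum_congr rfl fun k _ => ?_
    rw [hξ, hpdef, Polynomial.coeff_map, coeff_gainPolynomial]
    simp
  have hconv := exists_tendsto_of_stable_chain n p hp hdeg hroot ξ hξc hξd ⟨(c : ℂ), by
    simp only [hsum]
    exact (Complex.continuous_ofReal.tendsto c).comp hc⟩
  choose! l hl using hconv
  have hl0 : ∀ k < n, l (k + 1) = 0 := fun k hk =>
    eq_zero_of_tendsto_right_deriv (hξc k hk.le) (hξd k hk) (hl k hk.le) (hl (k + 1) hk)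
  have hre : ∀ k : Fin (n + 1), Tendsto (fun t => x t k) atTop (𝓝 (l k).re) := fun k => by
    have := (Complex.continuous_re.tendsto _).comp (hl k (Nat.le_of_lt_succ k.2))
    rw [hξ] at this
    simpa [Function.comp_def] using this
  -- `K₂ a 0` is the constant coefficient; were it zero, `0` would be a root. For `n = 0` it is `1`.
  have hK : K₂ a 0 ≠ 0 := by
    intro h
    have := ha 0 (by
      rw [← Polynomial.coeff_zero_eq_aeval_zero', ← Fin.val_zero (n + 1), coeff_gainPolynomial, h]
      simp)
    simp at this
  have hlim0 : K₂ a 0 * (l 0).re = c := by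
    have h1 : Tendsto (fun t => K₂ a ⬝ᵥ x t) atTop (𝓝 (∑ k, K₂ a k * (l k).re)) :=
      tendsto_finsetSum _ fun k _ => (hre k).const_mul _
    rw [tendsto_nhds_unique hc h1, Fin.sum_univ_succ]
    simp [hl0]
  rw [tendsto_pi_nhds]
  intro k
  convert hre k using 2
  refine Fin.cases ?_ (fun k => ?_) k
  · rw [← hlim0]; simp [hK]
  · simp [hl0]

end Gains

end HighOrderConsensus

namespace HighOrderConsensus

/-! ### Necessity: modes of agents in agreement -/

section Necessity

variable {n N : ℕ} {S : Type*}

/-- Agents that start in agreement evolve in agreement as a single uncontrolled chain. -/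
theorem isTrajectory_of_agreement (𝒯 : SwitchingTopology N S) (a : Fin n → ℝ) (σ : ℝ → S)
    {x : ℝ → Fin (n + 1) → ℝ}
    (hd : ∀ t, HasDerivAt x (integratorChain (x t) (K₁ a ⬝ᵥ x t)) t) :
    IsTrajectory 𝒯 a σ (fun t _ => x t) := by
  refine ⟨continuousOn_pi.2 fun _ t _ => (hd t).continuousAt.continuousWithinAt, fun t _ i => ?_⟩
  have : protocol 𝒯 a (σ t) (fun _ => x t) i = K₁ a ⬝ᵥ x t := by simp [protocol]
  rw [this]
  exact (hd t).hasDerivWithinAt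

theorem tendsto_of_solvesConsensus (hN : 0 < N) {𝒯 : SwitchingTopology N S} {a : Fin n → ℝ}
    {σ : ℝ → S} (h : SolvesConsensus 𝒯 a σ) {x : ℝ → Fin (n + 1) → ℝ}
    (hd : ∀ t, HasDerivAt x (integratorChain (x t) (K₁ a ⬝ᵥ x t)) t) (k : Fin (n + 1)) :
    ∃ c, Tendsto (fun t => x t k) atTop (𝓝 c) := by
  obtain ⟨c, hc⟩ := h _ (isTrajectory_of_agreement 𝒯 a σ hd)
  exact ⟨c k, tendsto_pi_nhds.1 (hc ⟨0, hN⟩) k⟩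

theorem hasDerivAt_chain {x : ℝ → Fin (n + 1) → ℝ} {u t : ℝ}
    (h : ∀ k : Fin n, HasDerivAt (fun r => x r k.castSucc) (x t k.succ) t)
    (hu : HasDerivAt (fun r => x r (Fin.last n)) u t) :
    HasDerivAt x (integratorChain (x t) u) t := by
  rw [hasDerivAt_pi]
  intro k
  refine Fin.lastCases ?_ (fun k => ?_) k
  · simpa [integratorChain] using hu
  · simpa [integratorChain] using h k

/-- A real-linear functional of the exponential mode of a root solves the uncontrolled chain. -/
theorem hasDerivAt_exponential_mode {a : Fin n → ℝ} {z : ℂ}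
    (hz : Polynomial.aeval z (gainPolynomial a) = 0) (φ : ℂ →L[ℝ] ℝ) (t : ℝ) :
    HasDerivAt (fun (r : ℝ) (k : Fin (n + 1)) => φ (z ^ (k : ℕ) * Complex.exp (z * r)))
      (integratorChain (fun k => φ (z ^ (k : ℕ) * Complex.exp (z * t)))
        (K₁ a ⬝ᵥ fun k => φ (z ^ (k : ℕ) * Complex.exp (z * t)))) t := by
  have hφ : ∀ k : ℕ, HasDerivAt (fun r : ℝ => φ (z ^ k * Complex.exp (z * r)))
      (φ (z ^ (k + 1) * Complex.exp (z * t))) t := by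
    intro k
    have h1 : HasDerivAt (fun r : ℝ => z * (r : ℂ)) (z * 1) t :=
      Complex.ofRealCLM.hasDerivAt.const_mul z
    refine (φ.hasFDerivAt.comp_hasDerivAt t (h1.cexp.const_mul (z ^ k))).congr_deriv ?_
    congr 1
    ring
  refine hasDerivAt_chain (fun k => by simpa using hφ k) ?_
  refine (hφ n).congr_deriv ?_
  rw [K₁_dotProduct]
  -- This is `z * p(z) = 0`, the characteristic equation of the chain under `K₁`.
  have h0 : z ^ (n + 1) * Complex.exp (z * t) =
      -∑ k : Fin n, a k • (z ^ ((k : ℕ) + 1) * Complex.exp (z * t)) := by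
    rw [aeval_gainPolynomial] at hz
    rw [eq_neg_iff_add_eq_zero]
    calc _ = (z ^ n + ∑ k : Fin n, (a k : ℂ) * z ^ (k : ℕ)) * (z * Complex.exp (z * t)) := by
          rw [add_mul, Finset.sum_mul]
          congr 1
          · ring
          · exact Finset.sum_congr rfl fun k _ => by rw [Complex.real_smul]; ring
      _ = 0 := by rw [hz, zero_mul]
  rw [h0, map_neg, map_sum]
  simp only [map_smul, smul_eq_mul, Fin.val_succ]

/-- The limit is nonzero since the modulus is at least `1` for `t ≥ 0`; a time shift by `s`
multiplies it by `exp (z * s)`, which must therefore be `1` for all `s`. -/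
theorem eq_zero_of_tendsto_exp {z c : ℂ} (hz : 0 ≤ z.re)
    (h : Tendsto (fun t : ℝ => Complex.exp (z * t)) atTop (𝓝 c)) : z = 0 := by
  have hc : c ≠ 0 := by
    rintro rfl
    have h1 := (tendsto_norm_zero.comp h).eventually_lt_const one_pos
    obtain ⟨t, ht, ht0⟩ := (h1.and (eventually_ge_atTop 0)).exists
    have : (1 : ℝ) ≤ ‖Complex.exp (z * t)‖ := by
      rw [Complex.norm_exp]
      exact Real.one_le_exp (by simpa using mul_nonneg hz ht0)
    exact absurd ht (not_lt.2 this)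
  have hone : ∀ s : ℝ, Complex.exp (z * s) = 1 := by
    intro s
    have h1 : Tendsto (fun t : ℝ => Complex.exp (z * (t + s : ℝ))) atTop (𝓝 c) :=
      h.comp (tendsto_atTop_add_const_right _ s tendsto_id)
    have h2 := h.mul_const (Complex.exp (z * s))
    have h3 := tendsto_nhds_unique h1 (h2.congr fun t => by
      rw [← Complex.exp_add]; push_cast; ring_nf)
    exact mul_left_cancel₀ hc (by rw [← h3, mul_one])
  have hd : HasDerivAt (fun r : ℝ => Complex.exp (z * (r : ℂ)))
      (Complex.exp (z * (0 : ℝ)) * (z * 1)) 0 :=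
    (Complex.ofRealCLM.hasDerivAt.const_mul z).cexp
  simp only [hone] at hd
  simpa using hd.unique (hasDerivAt_const (0 : ℝ) (1 : ℂ))

/-- If the gain polynomial vanishes at the origin, the uncontrolled chain has a linear drift. -/
theorem hasDerivAt_drift {a : Fin (n + 1) → ℝ} (ha : a 0 = 0) (t : ℝ) :
    HasDerivAt (fun (r : ℝ) => (Fin.cons r (Pi.single 0 1) : Fin (n + 2) → ℝ))
      (integratorChain (Fin.cons t (Pi.single 0 1))
        (K₁ a ⬝ᵥ (Fin.cons t (Pi.single 0 1) : Fin (n + 2) → ℝ))) t := by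
  refine hasDerivAt_chain (fun k => ?_) ?_
  · refine Fin.cases ?_ (fun k => ?_) k
    · simpa using hasDerivAt_id' t
    · simpa [← Fin.succ_castSucc] using hasDerivAt_const t _
  · rw [K₁_dotProduct]
    simpa [← Fin.succ_last, Pi.single_apply, ha] using hasDerivAt_const t _

theorem isHurwitz_of_solvesConsensus (hN : 0 < N) {𝒯 : SwitchingTopology N S} {a : Fin n → ℝ}
    {σ : ℝ → S} (h : SolvesConsensus 𝒯 a σ) : IsHurwitz (gainPolynomial a) := by
  intro z hz
  by_contra! hre
  have hlim : ∀ φ : ℂ →L[ℝ] ℝ,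
      ∃ c, Tendsto (fun t : ℝ => φ (Complex.exp (z * t))) atTop (𝓝 c) := fun φ => by
    simpa using tendsto_of_solvesConsensus hN h (hasDerivAt_exponential_mode hz φ) 0
  obtain ⟨u, hu⟩ := hlim Complex.reCLM
  obtain ⟨v, hv⟩ := hlim Complex.imCLM
  have hz0 : z = 0 := eq_zero_of_tendsto_exp hre (c := u + v * Complex.I) <|
    ((Complex.continuous_ofReal.tendsto u).comp hu |>.add
      (((Complex.continuous_ofReal.tendsto v).comp hv).mul_const Complex.I)).congr fun t => by
        simp
  subst hz0
  rw [aeval_gainPolynomial] at hz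
  -- The mode of the root `0` is constant and gives no contradiction; the drift solution does.
  cases n with
  | zero => simp at hz
  | succ n =>
    have ha : a 0 = 0 := by
      rw [Fin.sum_univ_succ] at hz
      simpa using hz
    obtain ⟨c, hc⟩ := tendsto_of_solvesConsensus hN h (hasDerivAt_drift ha) 0
    simp only [Fin.cons_zero] at hc
    exact not_tendsto_nhds_of_tendsto_atTop tendsto_id c hc

end Necessity

/-! ### Sufficiency: from joint connectivity to consensus -/

section Sufficiency

variable {n N : ℕ} {S : Type*}

theorem exists_transition {α : Type*} {R : α → α → Prop} {P : α → Prop} {x y : α}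
    (h : Relation.TransGen R x y) (hx : ¬ P x) (hy : P y) : ∃ u v, R u v ∧ ¬ P u ∧ P v := by
  induction h with
  | single h => exact ⟨_, _, h, hx, hy⟩
  | @tail b d _ hbd ih =>
    by_cases hb : P b
    · exact ih hb
    · exact ⟨_, _, hbd, hb, hy⟩

theorem exists_dwell_interval {σ : ℝ → S} {τ : ℝ} (hτ : 0 < τ) {u : ℕ → ℝ}
    (hu : ∀ k, τ ≤ u (k + 1) - u k) (hσ : ∀ k, ∀ s ∈ Ico (u k) (u (k + 1)), σ s = σ (u k))
    {r : ℝ} (hr : u 0 ≤ r) :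
    ∃ s, r - τ ≤ s ∧ s ≤ r ∧ ∀ r' ∈ Ico s (s + τ), σ r' = σ r := by
  have hgrow : ∀ k : ℕ, u 0 + k * τ ≤ u k := by
    intro k
    induction k with
    | zero => simp
    | succ k ih => push_cast; linarith [hu k]
  have hex : ∃ k, r < u k := by
    obtain ⟨k, hk⟩ := exists_nat_gt ((r - u 0) / τ)
    rw [div_lt_iff₀ hτ] at hk
    exact ⟨k, by linarith [hgrow k]⟩
  classical
  obtain ⟨k, hk⟩ : ∃ k, Nat.find hex = k + 1 :=
    Nat.exists_eq_succ_of_ne_zero fun h0 => by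
      have := Nat.find_spec hex
      rw [h0] at this
      linarith
  have hlt : r < u (k + 1) := hk ▸ Nat.find_spec hex
  have hle : u k ≤ r := not_lt.1 (Nat.find_min hex (by omega))
  -- Starting no earlier than `u k` and ending at `u k + τ` or `r` keeps the interval inside `[u k,
  -- u (k + 1))`.
  refine ⟨max (u k) (r - τ), le_max_right _ _, max_le hle (by linarith), fun r' hr' => ?_⟩
  rw [hσ k r ⟨hle, hlt⟩]
  refine hσ k r' ⟨(le_max_left _ _).trans hr'.1, hr'.2.trans_le ?_⟩
  rcases max_cases (u k) (r - τ) with h | h <;> rw [h.1] <;> linarith [hu k]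

open Classical in
/-- Weight of the edge from `j` to `i` at time `t`, zero when there is no such edge. -/
noncomputable def activeWeight (𝒯 : SwitchingTopology N S) (σ : ℝ → S) (t : ℝ) (i j : Fin N) : ℝ :=
  if (𝒯.graph (σ t)).Adj j i then 𝒯.weight (σ t) i j else 0

theorem activeWeight_nonneg (𝒯 : SwitchingTopology N S) (σ : ℝ → S) (t : ℝ) (i j : Fin N) :
    0 ≤ activeWeight 𝒯 σ t i j := by
  unfold activeWeight
  split_ifs with h
  exacts [(𝒯.weight_pos _ _ _ h).le, le_rfl]

theorem exists_activeWeight_sum_le [Finite S] (𝒯 : SwitchingTopology N S) (σ : ℝ → S) :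
    ∃ B, 0 ≤ B ∧ ∀ t i, ∑ j, activeWeight 𝒯 σ t i j ≤ B := by
  obtain ⟨B, hB⟩ := Finite.exists_le fun p : S × Fin N =>
    ∑ j, activeWeight 𝒯 (fun _ => p.1) 0 p.2 j
  exact ⟨max B 0, le_max_right _ _, fun t i => (hB (σ t, i)).trans (le_max_left _ _)⟩

theorem exists_pos_le_weight [Finite S] (𝒯 : SwitchingTopology N S) :
    ∃ α, 0 < α ∧ ∀ s i j, (𝒯.graph s).Adj j i → α ≤ 𝒯.weight s i j := by
  obtain ⟨A, hA⟩ := Finite.exists_le fun p : S × Fin N × Fin N =>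
    (𝒯.weight p.1 p.2.1 p.2.2)⁻¹
  refine ⟨(max A 1)⁻¹, by positivity, fun s i j h => ?_⟩
  exact inv_le_of_inv_le₀ (𝒯.weight_pos s i j h) ((hA (s, i, j)).trans (le_max_left _ _))

theorem averagingFlow_of_isTrajectory {𝒯 : SwitchingTopology N S} {a : Fin n → ℝ} {σ : ℝ → S}
    {X : ℝ → Fin N → Fin (n + 1) → ℝ} (hX : IsTrajectory 𝒯 a σ X) {B : ℝ}
    (hB : ∀ t i, ∑ j, activeWeight 𝒯 σ t i j ≤ B) :
    AveragingFlow (activeWeight 𝒯 σ) B (fun t i => K₂ a ⬝ᵥ X t i) where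
  nonneg := activeWeight_nonneg 𝒯 σ
  sum_le := hB
  continuousOn i := continuousOn_finsetSum _ fun k _ =>
    continuousOn_const.mul (continuousOn_pi.1 (continuousOn_pi.1 hX.1 i) k)
  deriv t ht i := by
    have h := HasDerivWithinAt.fun_sum (u := Finset.univ) fun k _ =>
      (hasDerivWithinAt_pi.1 (hX.2 t ht i) k).const_mul (K₂ a k)
    have e : ∑ k, K₂ a k * integratorChain (X t i) (protocol 𝒯 a (σ t) (X t) i) k =
        ∑ j, activeWeight 𝒯 σ t i j * (K₂ a ⬝ᵥ X t j - K₂ a ⬝ᵥ X t i) := by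
      change K₂ a ⬝ᵥ integratorChain _ _ = _
      rw [protocol, sub_eq_add_neg, K₂_dotProduct_integratorChain, Finset.sum_filter,
        ← Finset.sum_neg_distrib]
      refine Finset.sum_congr rfl fun j _ => ?_
      rw [activeWeight, dotProduct_sub]
      split_ifs
      · ring
      · simp
    rw [e] at h
    exact h

theorem windowConnected_of_uniformlyJointlyQSC {𝒯 : SwitchingTopology N S} {σ : ℝ → S}
    (hσ : HasDwellTime σ) (hG : UniformlyJointlyQSC 𝒯.graph σ) {α : ℝ}
    (hα : ∀ s i j, (𝒯.graph s).Adj j i → α ≤ 𝒯.weight s i j) :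
    ∃ τ T t₀ : ℝ, 0 < τ ∧ 0 ≤ T ∧ 0 ≤ t₀ ∧
      ∀ t, t₀ ≤ t → AveragingFlow.WindowConnected (activeWeight 𝒯 σ) τ α T t := by
  obtain ⟨τ, hτ, u, hu0, hu, -, hconst⟩ := hσ
  obtain ⟨T, hT, hQ⟩ := hG
  -- The dwell interval of an edge seen in `[t + τ, t + τ + T)` may overhang by `τ` on either side;
  -- starting at `u 0` ensures that it exists.
  refine ⟨τ, T + 2 * τ, u 0, hτ, by linarith, hu0, fun t ht P Q hP hQn hdisj => ?_⟩
  obtain ⟨c, hc⟩ := hQ (t + τ) (by linarith)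
  have key : ∀ P : Finset (Fin N), P.Nonempty → c ∉ P → ∃ i j s, t ≤ s ∧ s + τ ≤ t + (T + 2 * τ) ∧
      (i ∈ P ∧ j ∉ P) ∧ ∀ r ∈ Ico s (s + τ), α ≤ activeWeight 𝒯 σ r i j := by
    rintro P ⟨k, hk⟩ hcP
    obtain ⟨j, i, ⟨r, hr, hadj⟩, hj, hi⟩ :=
      exists_transition (P := (· ∈ P)) (hc k fun h => hcP (h ▸ hk)) hcP hk
    obtain ⟨s, hs1, hs2, hs⟩ := exists_dwell_interval hτ hu hconst (r := r) (by linarith [hr.1])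
    refine ⟨i, j, s, by linarith [hr.1], by linarith [hr.2], ⟨hi, hj⟩, fun r' hr' => ?_⟩
    rw [activeWeight, hs r' hr', if_pos hadj]
    exact hα _ _ _ hadj
  by_cases hcP : c ∈ P
  · obtain ⟨i, j, s, h1, h2, h3, h4⟩ := key Q hQn (Finset.disjoint_left.1 hdisj hcP)
    exact ⟨i, j, s, h1, h2, Or.inr h3, h4⟩
  · obtain ⟨i, j, s, h1, h2, h3, h4⟩ := key P hP hcP
    exact ⟨i, j, s, h1, h2, Or.inl h3, h4⟩

theorem consensus_of_uniformlyJointlyQSC (hN : 0 < N) [Finite S] {𝒯 : SwitchingTopology N S}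
    {σ : ℝ → S} (hσ : HasDwellTime σ) {a : Fin n → ℝ} (ha : IsHurwitz (gainPolynomial a))
    (hG : UniformlyJointlyQSC 𝒯.graph σ) {X : ℝ → Fin N → Fin (n + 1) → ℝ}
    (hX : IsTrajectory 𝒯 a σ X) :
    ∃ xbar : ℝ,
      (∀ i, Tendsto (fun t => K₂ a ⬝ᵥ X t i) atTop (𝓝 xbar)) ∧
      ∀ i, Tendsto (fun t => X t i) atTop (𝓝 (Pi.single 0 (xbar / K₂ a 0))) := by
  have : Nonempty (Fin N) := ⟨⟨0, hN⟩⟩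
  obtain ⟨B, hB0, hB⟩ := exists_activeWeight_sum_le 𝒯 σ
  obtain ⟨α, hα0, hα⟩ := exists_pos_le_weight 𝒯
  obtain ⟨τ, T, t₀, hτ, hT, ht₀, hconn⟩ := windowConnected_of_uniformlyJointlyQSC hσ hG hα
  obtain ⟨c, hc⟩ :=
    (averagingFlow_of_isTrajectory hX hB).exists_tendsto hB0 hτ hα0 hT ht₀ hconn
  refine ⟨c, hc, fun i => tendsto_of_isHurwitz ha (continuousOn_pi.1 hX.1 i)
    (fun t ht k => ?_) (hc i)⟩
  simpa [integratorChain] using hasDerivWithinAt_pi.1 (hX.2 t ht i) k.castSucc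

end Sufficiency

end HighOrderConsensus

open HighOrderConsensus
theorem theorem1 {n N : ℕ} (hN : 0 < N) {S : Type*} [Finite S]
    (𝒯 : SwitchingTopology N S) (σ : ℝ → S) (hσ : HasDwellTime σ) (a : Fin n → ℝ) :
    (IsHurwitz (gainPolynomial a) → UniformlyJointlyQSC 𝒯.graph σ →
      SolvesConsensus 𝒯 a σ ∧
      ∀ X : ℝ → Fin N → Fin (n + 1) → ℝ, IsTrajectory 𝒯 a σ X →
        ∃ xbar : ℝ,
          (∀ i, Tendsto (fun t => K₂ a ⬝ᵥ X t i) atTop (𝓝 xbar)) ∧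
          ∀ i, Tendsto (fun t => X t i) atTop (𝓝 (Pi.single 0 (xbar / K₂ a 0)))) ∧
    (SolvesConsensus 𝒯 a σ → IsHurwitz (gainPolynomial a)) := by
  refine ⟨fun ha hG => ⟨fun X hX => ?_, fun X hX =>
    consensus_of_uniformlyJointlyQSC hN hσ ha hG hX⟩, isHurwitz_of_solvesConsensus hN⟩
  obtain ⟨c, -, hc⟩ := consensus_of_uniformlyJointlyQSC hN hσ ha hG hX
  exact ⟨_, hc⟩
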